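/- Conventions. A represented space is a set $X$ with a partial surjection $\delta_X :\subseteq \{0,1\}^{\mathbb N} \to X$; if $\delta_X(p)=x$, then $p$ is called a name of $x$. A partial function on $\{0,1\}^{\mathbb N}$ is computable if it is computed by a Type-2 machine. A partial function $F$ on $\{0,1\}^{\mathbb N}$ realizes a (possibly partial, multivalued) function $f$ between represented spaces if it maps every name of every $x \in \operatorname{dom}(f)$ to a name of some element of $f(x)$; $f$ is computable if it has a computable realizer. A computable metric space is a metric space with a fixed dense sequence $(a_i)_{i\in\mathbb N}$ such that $d(a_i,a_j)$ is computable from $i,j$; it carries the Cauchy representation. $\mathcal C(\mathbf X,\mathbf Y)$ is the represented space of functions with a continuous realizer (a name being a code of such a realizer), and $\mathcal A(\mathbf X)$ is the represented space of closed subsets of $\mathbf X$ (a name of $A$ being a name of the characteristic function of $X\setminus A$ as a continuous function from $\mathbf X$ to Sierpiński space). For $f$, $g$ (partial, multivalued) between represented spaces, $f \leq_{\mathrm W} g$ means that there are computable $H,K$ such that $p \mapsto H(\langle p, G(K(p))\rangle)$ realizes $f$ whenever $G$ realizes $g$. $C_{\mathbb N}$ is the multivalued function that maps a nonempty $A \in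 \mathcal A(\mathbb N)$ to an arbitrary element of $A$. Finally, $\mathcal C^{\mathcal A\text{-pw}}(\mathbf X,\mathbf Z)$ is the represented space of those $g : X \to Z$ for which there is a sequence of pairs $(A_i, g_i)_{i \in \mathbb N}$ with $A_i \in \mathcal A(\mathbf X)$, $\bigcup_{i} A_i = X$ and $g_i = g|_{A_i} \in \mathcal C(A_i,\mathbf Z)$; a name of $g$ is a name of such a sequence. Theorem. Let $\mathbf X$, $\mathbf Z$ be computable metric spaces and $\mathbf Y$ a represented space. If $f : \mathbf X \times \mathbf Y \to \mathbf Z$ satisfies $f \leq_{\mathrm W} C_{\mathbb N}$, then, for every $y \in Y$, the function $x \mapsto f(x,y)$ belongs to $\mathcal C^{\mathcal A\text{-pw}}(\mathbf X,\mathbf Z)$, and the map $y \mapsto (x \mapsto f(x,y)) : \mathbf Y \to \mathcal C^{\mathcal A\text{-pw}}(\mathbf X,\mathbf Z)$ is computable. -/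

import Mathlib

namespace CompAnalysis

/-! ### Type-2 computability on Cantor space -/

/-- Cantor space, the space of names. -/
abbrev Cantor : Type := ℕ → Bool

/-- The first `n` symbols of `p`. -/
def initSeg (p : Cantor) (n : ℕ) : List Bool := (List.range n).map p

/-- A (deterministic) Type-2 machine, given by the word `out w` that stands on its one-way output
tape after it has run for `|w|` steps on an input tape that starts with `w`; in that time it cannot
have read past `w`. The word `out w` is computable from `w`, and written symbols are never
changed. -/
structure TypeTwoMachine where
  out : List Bool → List Bool
  computable : Computable out
  mono : ∀ w v : List Bool, w <+: v → out w <+: out v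

/-- On the input `p` the machine writes the infinite sequence `q`. -/
def TypeTwoMachine.Writes (M : TypeTwoMachine) (p q : Cantor) : Prop :=
  ∀ n, ∃ m, initSeg q n <+: M.out (initSeg p m)

/-- `F : ⊆ {0,1}^ℕ → {0,1}^ℕ` is computable: it is the function computed by some Type-2 machine
(which is defined exactly where the machine writes an infinite sequence). -/
def IsComputable (F : Cantor →. Cantor) : Prop :=
  ∃ M : TypeTwoMachine, ∀ p q, q ∈ F p ↔ M.Writes p q

/-- The pairing `⟨p, q⟩ = p₀ q₀ p₁ q₁ …`. -/
def pair (p q : Cantor) : Cantor := fun n => if n % 2 = 0 then p (n / 2) else q (n / 2)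

/-- The first component of `r = ⟨p, q⟩`. -/
def left (r : Cantor) : Cantor := fun n => r (2 * n)

/-- The second component of `r = ⟨p, q⟩`. -/
def right (r : Cantor) : Cantor := fun n => r (2 * n + 1)

/-- The universal function: `UnivWrites r p q` says that `η_r(p) = q`, where `η_r` is the partial
continuous function on Cantor space with the code `r`. The code `r` is the characteristic
sequence of a set of pairs of words `(w, v)`, read as `on inputs that start with w, write (at least)
v`. Then `η_r(p)` is defined as `q` if `r` demands every finite piece of `q` on some finite piece of
`p`, and never demands anything that contradicts `q`. -/
def UnivWrites (r p q : Cantor) : Prop :=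
  (∀ n, ∃ m, r (Encodable.encode (initSeg p m, initSeg q n)) = true) ∧
    ∀ m v, r (Encodable.encode (initSeg p m, v)) = true → v = initSeg q v.length

theorem initSeg_length (p : Cantor) (n : ℕ) : (initSeg p n).length = n := by
  simp [initSeg]

theorem eq_of_initSeg {p q : Cantor} (h : ∀ n, initSeg p n = initSeg q n) : p = q := by
  funext n
  have := congrArg (fun l : List Bool => l[n]?) (h (n + 1))
  simpa [initSeg] using this

theorem UnivWrites.unique {r p q q' : Cantor} (h : UnivWrites r p q) (h' : UnivWrites r p q') :
    q = q' := by
  refine eq_of_initSeg fun n => ?_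
  obtain ⟨m, hm⟩ := h.1 n
  have := h'.2 m _ hm
  rwa [initSeg_length] at this

/-! ### Represented spaces -/

/-- A representation of `X`: a partial surjection `δ` from Cantor space onto `X`, given by its
graph; `Names p x` says that `δ(p) = x`. -/
structure CantorRep (X : Type*) where
  Names : Cantor → X → Prop
  unique : ∀ {p x x'}, Names p x → Names p x' → x = x'
  surj : ∀ x, ∃ p, Names p x

/-- The representation of the space of all `t` that have a name. -/
def CantorRep.ofNames {T : Type*} (N : Cantor → T → Prop)
    (h : ∀ {p t t'}, N p t → N p t' → t = t') : CantorRep {t : T // ∃ p, N p t} where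
  Names p t := N p t.1
  unique h₁ h₂ := Subtype.ext (h h₁ h₂)
  surj t := t.2

/-- The product `X × Y` of represented spaces. -/
def CantorRep.prod {X Y : Type*} (δX : CantorRep X) (δY : CantorRep Y) :
    CantorRep (X × Y) where
  Names p z := δX.Names (left p) z.1 ∧ δY.Names (right p) z.2
  unique h h' := Prod.ext (δX.unique h.1 h'.1) (δY.unique h.2 h'.2)
  surj z := by
    obtain ⟨p, hp⟩ := δX.surj z.1
    obtain ⟨q, hq⟩ := δY.surj z.2
    have hl : left (pair p q) = p := by
      funext n
      simp [left, pair]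
    have hr : right (pair p q) = q := by
      funext n
      have h1 : (2 * n + 1) % 2 ≠ 0 := by omega
      have h2 : (2 * n + 1) / 2 = n := by omega
      simp only [right, pair, h2, if_neg h1]
    exact ⟨pair p q, hl.symm ▸ hp, hr.symm ▸ hq⟩

/-- The subspace `A` of a represented space. -/
def CantorRep.restrict {X : Type*} (δ : CantorRep X) (A : Set X) :
    CantorRep A where
  Names p x := δ.Names p x.1
  unique h h' := Subtype.ext (δ.unique h h')
  surj x := δ.surj x.1

/-- The natural numbers: the name of `n` is `0ⁿ 1 0 0 0 …`. -/
def natRep : CantorRep ℕ where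
  Names p n := ∀ m, p m = true ↔ m = n
  unique h h' := (h' _).1 ((h _).2 rfl)
  surj n := ⟨fun m => decide (m = n), fun m => by simp⟩

/-- Sierpiński space, with points the truth values: `0 0 0 …` is the name of `⊥`, all other
sequences are names of `⊤`. -/
def sierpinskiRep : CantorRep Prop where
  Names p s := s ↔ ∃ n, p n = true
  unique h h' := propext (h.trans h'.symm)
  surj s := by
    by_cases hs : s
    · exact ⟨fun _ => true, by simp [hs]⟩
    · exact ⟨fun _ => false, by simp [hs]⟩

/-! ### Function spaces and closed sets -/

section Spaces

variable {X Y : Type*} (δX : CantorRep X) (δY : CantorRep Y)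

/-- `r` is a name of `f` in `C(X, Y)`: the partial function `η_r` is a realizer of `f`. -/
def IsFunctionName (r : Cantor) (f : X → Y) : Prop :=
  ∀ p x, δX.Names p x → ∃ q, UnivWrites r p q ∧ δY.Names q (f x)

variable {δX δY} in
theorem IsFunctionName.unique {r : Cantor} {f g : X → Y} (hf : IsFunctionName δX δY r f)
    (hg : IsFunctionName δX δY r g) : f = g := by
  funext x
  obtain ⟨p, hp⟩ := δX.surj x
  obtain ⟨q, hq, hqf⟩ := hf p x hp
  obtain ⟨q', hq', hqg⟩ := hg p x hp
  obtain rfl := hq.unique hq'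
  exact δY.unique hqf hqg

/-- `r` is a name of `A` in the space `𝒜(X)` of closed sets, i.e. a name of the complement of `A`
as an open set, i.e. of its characteristic function in `C(X, 𝕊)`. -/
def IsClosedName (r : Cantor) (A : Set X) : Prop :=
  IsFunctionName δX sierpinskiRep r (fun x => x ∉ A)

variable {δX} in
theorem IsClosedName.unique {r : Cantor} {A B : Set X} (hA : IsClosedName δX r A)
    (hB : IsClosedName δX r B) : A = B := by
  ext x
  exact not_iff_not.1 (iff_of_eq (congrFun (IsFunctionName.unique hA hB) x))

/-- The closed subsets of a represented space `X`, the points of `𝒜(X)`. -/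
abbrev ClosedSet : Type _ := {A : Set X // ∃ r, IsClosedName δX r A}

/-- The represented space `𝒜(X)`. -/
def closedRep : CantorRep (ClosedSet δX) :=
  CantorRep.ofNames (IsClosedName δX) IsClosedName.unique

/-- `r` is a name of `f` in `C^{𝒜-pw}(X, Y)`: as a point of `C(ℕ, ·)`, it is a name of a sequence
of pairs `(A i, f i)` with `A i ∈ 𝒜(X)` and `f i ∈ C(A i, Y)`, where the `A i` cover `X` and `f i` is
the restriction of `f` to `A i`. -/
def IsPiecewiseName (r : Cantor) (f : X → Y) : Prop :=
  ∃ A : ℕ → Set X, (⋃ i, A i) = Set.univ ∧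
    ∀ p i, natRep.Names p i → ∃ s, UnivWrites r p s ∧
      IsClosedName δX (left s) (A i) ∧
      IsFunctionName (δX.restrict (A i)) δY (right s) (fun x => f x.1)

variable {δX δY} in
theorem IsPiecewiseName.unique {r : Cantor} {f g : X → Y} (hf : IsPiecewiseName δX δY r f)
    (hg : IsPiecewiseName δX δY r g) : f = g := by
  obtain ⟨A, hA, hf⟩ := hf
  obtain ⟨B, -, hg⟩ := hg
  funext x
  obtain ⟨i, hi⟩ := Set.mem_iUnion.1 (hA ▸ Set.mem_univ x)
  obtain ⟨p, hp⟩ := natRep.surj i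
  obtain ⟨s, hs, hsA, hsf⟩ := hf p i hp
  obtain ⟨s', hs', hsB, hsg⟩ := hg p i hp
  obtain rfl := hs.unique hs'
  have hAB := hsA.unique hsB
  rw [← hAB] at hsg
  exact congrFun (hsf.unique hsg) ⟨x, hi⟩

/-- The `𝒜`-piecewise continuous functions from `X` to `Y`, the points of `C^{𝒜-pw}(X, Y)`. -/
abbrev PiecewiseContinuousMap : Type _ := {f : X → Y // ∃ r, IsPiecewiseName δX δY r f}

/-- The represented space `C^{𝒜-pw}(X, Y)`. -/
def piecewiseRep : CantorRep (PiecewiseContinuousMap δX δY) :=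
  CantorRep.ofNames (IsPiecewiseName δX δY) IsPiecewiseName.unique

/-! ### Realizers and Weihrauch reducibility -/

/-- `F` is a realizer of the multivalued function `f : ⊆ X ⇉ Y`, where `f x` is the set of values at
`x` and `x` is in the domain of `f` if this set is non-empty. -/
def Realizes (F : Cantor →. Cantor) (f : X → Set Y) : Prop :=
  ∀ p x, δX.Names p x → (f x).Nonempty → ∃ q ∈ F p, ∃ y ∈ f x, δY.Names q y

/-- The (total, single-valued) map `f : X → Y` is computable: it has a computable realizer. -/
def IsComputableMap (f : X → Y) : Prop :=
  ∃ F, IsComputable F ∧ Realizes δX δY F (fun x => {f x})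

/-- Weihrauch reducibility `f ≤_W g` for `f : ⊆ X ⇉ Y` and `g : ⊆ U ⇉ V`: there are computable `H`
and `K` such that `p ↦ H⟨p, G(K(p))⟩` is a realizer of `f` whenever `G` is a realizer of `g`. -/
def WeihrauchReducible {U V : Type*} (δU : CantorRep U) (δV : CantorRep V)
    (f : X → Set Y) (g : U → Set V) : Prop :=
  ∃ H K : Cantor →. Cantor, IsComputable H ∧ IsComputable K ∧
    ∀ G : Cantor →. Cantor, Realizes δU δV G g →
      Realizes δX δY (fun p => (K p).bind fun u => (G u).bind fun v => H (pair p v)) f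

/-- Closed choice `C_X : ⊆ 𝒜(X) ⇉ X`: given a non-empty closed set, find a point of it. -/
def closedChoice : ClosedSet δX → Set X := fun A => A.1

end Spaces

/-! ### Computable metric spaces -/

/-- The data that make a metric space a computable metric space: a dense sequence for which the
distances are computable from the indices (`D (i, j, k) / 2 ^ k` approximates the distance of the
`i`-th and the `j`-th point up to `2 ^ (-k)`). -/
structure ComputableMetric (X : Type*) [MetricSpace X] where
  pt : ℕ → X
  dense : DenseRange pt
  computable_dist : ∃ D : ℕ × ℕ × ℕ → ℕ, Computable D ∧
    ∀ i j k, |dist (pt i) (pt j) - (D (i, j, k) : ℝ) / 2 ^ k| ≤ 1 / 2 ^ k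

/-- The Cauchy representation of a computable metric space: a name of `x` is a sequence of indices
`s 0, s 1, …` such that the distance of `x` to the point with index `s k` is at most `2 ^ (-k)`. The
sequence `s` is coded by joining the names `0^(s k) 1 0 0 0 …` of all the `s k`. -/
def ComputableMetric.cauchyRep {X : Type*} [MetricSpace X] (c : ComputableMetric X) :
    CantorRep X where
  Names p x := ∃ s : ℕ → ℕ, (∀ k, natRep.Names (fun m => p (Nat.pair k m)) (s k)) ∧
    ∀ k, dist (c.pt (s k)) x ≤ 1 / 2 ^ k
  unique := by
    rintro p x x' ⟨s, hs, hx⟩ ⟨s', hs', hx'⟩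
    have hss : s = s' := funext fun k => natRep.unique (hs k) (hs' k)
    subst hss
    have h0 : Filter.Tendsto (fun k : ℕ => (1 : ℝ) / 2 ^ k) Filter.atTop (nhds 0) := by
      simpa [one_div, inv_pow] using
        tendsto_pow_atTop_nhds_zero_of_lt_one (r := (2 : ℝ)⁻¹) (by norm_num) (by norm_num)
    have h1 : Filter.Tendsto (fun k => c.pt (s k)) Filter.atTop (nhds x) :=
      tendsto_iff_dist_tendsto_zero.2 (squeeze_zero (fun _ => dist_nonneg) hx h0)
    have h2 : Filter.Tendsto (fun k => c.pt (s k)) Filter.atTop (nhds x') :=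
      tendsto_iff_dist_tendsto_zero.2 (squeeze_zero (fun _ => dist_nonneg) hx' h0)
    exact tendsto_nhds_unique h1 h2
  surj x := by
    have h : ∀ k : ℕ, ∃ i, dist (c.pt i) x ≤ 1 / 2 ^ k := fun k => by
      obtain ⟨i, hi⟩ := c.dense.exists_dist_lt x (ε := 1 / 2 ^ k) (by positivity)
      exact ⟨i, by rw [dist_comm]; exact hi.le⟩
    choose s hs using h
    refine ⟨fun n => decide (n.unpair.2 = s n.unpair.1), s, fun k m => ?_, hs⟩
    simp

end CompAnalysis

open CompAnalysis

/-!
Let `H` and `K` be machines that reduce `f` to closed choice on the natural numbers: on a name of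
`(x, y)`, `K` names a nonempty closed set of numbers, and every `n` in it enables `H` to compute
`f (x, y)`. Fix a name `q` of `y`. The difficulty is that the set named by `K` may depend on the
name of `x`, and not only on `x`.

The pieces deal with this by fixing a finite beginning of the name. For a finite sequence `t` of
indices of points and a number `n`, let `x` belong to the piece of `(t, n)` if `t` begins a name of
`x` and `K` never excludes `n` on a name of `x` extending `t`. By the argument of the Baire category
theorem, these pieces cover the space (`exists_mem_piece`). On each of them `f` can be evaluated
(`mem_of_mem_piece`): shift the given name of `x` by one place and put `t` in front; the result is a
name of `x` that extends `t`, hence `n` is a correct answer for it.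

For the pieces to be closed, with complements that can be enumerated from `q`, only names that
satisfy strict inequalities are taken into account: then the existence of a name of `x` extending
`t` on which `K` excludes `n` is an open condition, confirmed by a finite sequence and a good
approximation to `x`. That `t` itself begins a name of `x` is not a closed condition any more; it is
replaced by the closed conditions that it does so with a margin `2 ^ (-m)`, so that `m` becomes
part of the index of the piece (`ComputableMetric.piece`, `exists_outsideBit_iff`).

The realizers of all this are Type-2 machines that are allowed to guess a witness and only have to
verify it (`TypeTwoMachine.ofBits`), the length of the prefix of the input that has been read
serving as the guess. They are turned into names of points of function spaces by currying
(`univWrites_sectionCode`, `exists_machine_sectionCode`).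
-/

namespace CompAnalysis

/-! ### Closure properties of computable functions -/

section Computability

variable {α σ : Type*} [Primcodable α] [Primcodable σ]

theorem computable_map_range {f : α → ℕ → σ} {n : α → ℕ} (hf : Computable₂ f)
    (hn : Computable n) : Computable fun a => (List.range (n a)).map (f a) := by
  have h : Computable fun a => Nat.rec (motive := fun _ => List σ) []
      (fun k l => l ++ [f a k]) (n a) :=
    Computable.nat_rec hn (Computable.const [])
      (Computable.list_concat.comp (Computable.snd.comp Computable.snd)
        (hf.comp Computable.fst (Computable.fst.comp Computable.snd))).to₂
  refine h.of_eq fun a => ?_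
  induction n a with
  | zero => rfl
  | succ k ih => simp only [ih, List.range_succ, List.map_append, List.map_cons, List.map_nil]

theorem computable_all_range {f : α → ℕ → Bool} {n : α → ℕ} (hf : Computable₂ f)
    (hn : Computable n) : Computable fun a => (List.range (n a)).all (f a) := by
  have h : Computable fun a => Nat.rec (motive := fun _ => Bool) true
      (fun k b => b && f a k) (n a) :=
    Computable.nat_rec hn (Computable.const true)
      (Primrec.and.to_comp.comp (Computable.snd.comp Computable.snd)
        (hf.comp Computable.fst (Computable.fst.comp Computable.snd))).to₂
  refine h.of_eq fun a => ?_
  induction n a with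
  | zero => rfl
  | succ k ih => simp [ih, List.range_succ]

theorem computable_two_pow {f : α → ℕ} (hf : Computable f) : Computable fun a => 2 ^ f a :=
  (Primrec₂.unpaired'.1 Nat.Primrec.pow).to_comp.comp (Computable.const 2) hf

theorem computable_add {f g : α → ℕ} (hf : Computable f) (hg : Computable g) :
    Computable fun a => f a + g a := Primrec.nat_add.to_comp.comp hf hg

theorem computable_mul {f g : α → ℕ} (hf : Computable f) (hg : Computable g) :
    Computable fun a => f a * g a := Primrec.nat_mul.to_comp.comp hf hg

theorem computable_lt {f g : α → ℕ} (hf : Computable f) (hg : Computable g) :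
    Computable fun a => decide (f a < g a) := Primrec.nat_lt.decide.to_comp.comp hf hg

theorem computable_le {f g : α → ℕ} (hf : Computable f) (hg : Computable g) :
    Computable fun a => decide (f a ≤ g a) := Primrec.nat_le.decide.to_comp.comp hf hg

theorem computable_and {f g : α → Bool} (hf : Computable f) (hg : Computable g) :
    Computable fun a => f a && g a := Primrec.and.to_comp.comp hf hg

theorem computable_or {f g : α → Bool} (hf : Computable f) (hg : Computable g) :
    Computable fun a => f a || g a := Primrec.or.to_comp.comp hf hg

end Computability

/-! ### Initial segments and padded words -/

theorem initSeg_eq_iff {p q : Cantor} {n : ℕ} :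
    initSeg p n = initSeg q n ↔ ∀ k < n, p k = q k := by
  simp [initSeg, List.map_inj_left]

theorem initSeg_prefix (p : Cantor) {m n : ℕ} (h : m ≤ n) : initSeg p m <+: initSeg p n := by
  obtain ⟨k, rfl⟩ := Nat.exists_eq_add_of_le h
  simp [initSeg, List.range_add]

theorem take_initSeg (p : Cantor) {m n : ℕ} (h : m ≤ n) :
    (initSeg p n).take m = initSeg p m := by
  have := List.prefix_iff_eq_take.1 (initSeg_prefix p h)
  rw [this, initSeg_length]

/-- The sequence that starts with the word `w` and continues with zeros. -/
def pad (w : List Bool) : Cantor := fun k => w.getD k false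

theorem pad_initSeg {p : Cantor} {n k : ℕ} (h : k < n) : pad (initSeg p n) k = p k := by
  simp [pad, initSeg, h]

theorem lt_length_of_pad {w : List Bool} {k : ℕ} (h : pad w k = true) : k < w.length := by
  by_contra hk
  rw [pad, List.getD_eq_default _ _ (not_lt.1 hk)] at h
  exact Bool.false_ne_true h

theorem eq_true_of_pad_initSeg {p : Cantor} {n k : ℕ} (h : pad (initSeg p n) k = true) :
    p k = true := by
  have hk := lt_length_of_pad h
  rw [initSeg_length] at hk
  rwa [pad_initSeg hk] at h

theorem computable_pad : Computable₂ pad := (Primrec.list_getD false).to_comp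

theorem computable_initSeg {α : Type*} [Primcodable α] {p : α → Cantor} {n : α → ℕ}
    (hp : Computable₂ p) (hn : Computable n) : Computable fun a => initSeg (p a) (n a) :=
  computable_map_range hp hn

theorem computable_pair {α : Type*} [Primcodable α] {p q : α → Cantor}
    (hp : Computable₂ p) (hq : Computable₂ q) : Computable₂ fun a => pair (p a) (q a) := by
  have half : Computable fun z : α × ℕ => z.2 / 2 :=
    (Primrec.nat_div.comp Primrec.snd (Primrec.const 2)).to_comp
  refine (Computable.cond (c := fun z : α × ℕ => decide (z.2 % 2 = 0)) ?_
    (hp.comp Computable.fst half) (hq.comp Computable.fst half)).of_eq fun z => ?_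
  · exact (Primrec.eq.decide.comp (Primrec.nat_mod.comp Primrec.snd (Primrec.const 2))
      (Primrec.const 0)).to_comp
  · by_cases h : z.2 % 2 = 0 <;> simp [pair, h]

@[simp] theorem left_pair (p q : Cantor) : left (pair p q) = p := by
  funext n
  simp [left, pair]

@[simp] theorem right_pair (p q : Cantor) : right (pair p q) = q := by
  funext n
  have h1 : (2 * n + 1) % 2 ≠ 0 := by omega
  have h2 : (2 * n + 1) / 2 = n := by omega
  simp only [right, pair, h2, if_neg h1]

theorem initSeg_pair_congr {p p' q q' : Cantor} {n : ℕ} (hp : ∀ k < n, p k = p' k)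
    (hq : ∀ k < n, q k = q' k) : initSeg (pair p q) (2 * n) = initSeg (pair p' q') (2 * n) := by
  refine initSeg_eq_iff.2 fun k hk => ?_
  have : k / 2 < n := by omega
  simp [pair, hp _ this, hq _ this]

/-! ### Type-2 machines -/

theorem TypeTwoMachine.Writes.prefix {M : TypeTwoMachine} {p q : Cantor} (h : M.Writes p q)
    {m : ℕ} {v : List Bool} (hv : v <+: M.out (initSeg p m)) : v = initSeg q v.length := by
  obtain ⟨m', hm'⟩ := h v.length
  have h₁ := hv.trans (M.mono _ _ (initSeg_prefix p (le_max_left m m')))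
  have h₂ := hm'.trans (M.mono _ _ (initSeg_prefix p (le_max_right m m')))
  exact (List.prefix_of_prefix_length_le h₁ h₂ (by simp [initSeg_length])).eq_of_length
    (by simp [initSeg_length])

theorem TypeTwoMachine.Writes.unique {M : TypeTwoMachine} {p q q' : Cantor} (h : M.Writes p q)
    (h' : M.Writes p q') : q = q' := by
  refine eq_of_initSeg fun n => ?_
  obtain ⟨m, hm⟩ := h n
  simpa [initSeg_length] using h'.prefix hm

/-- A machine that writes `q` on input `p` has, for each position, written the symbol there after
finitely many steps. -/
theorem TypeTwoMachine.Writes.exists_getElem? {M : TypeTwoMachine} {p q : Cantor}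
    (h : M.Writes p q) (k : ℕ) :
    ∃ m, ∀ m' ≥ m, (M.out (initSeg p m'))[k]? = some (q k) := by
  obtain ⟨m, hm⟩ := h (k + 1)
  refine ⟨m, fun m' hm' => ?_⟩
  have := hm.trans (M.mono _ _ (initSeg_prefix p hm'))
  exact List.prefix_iff_getElem?.1 this k (by simp [initSeg_length]) |>.trans (by simp [initSeg])

theorem TypeTwoMachine.Writes.eq_of_getElem? {M : TypeTwoMachine} {p q : Cantor}
    (h : M.Writes p q) {m k : ℕ} {b : Bool} (hb : (M.out (initSeg p m))[k]? = some b) :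
    q k = b := by
  obtain ⟨m', hm'⟩ := h.exists_getElem? k
  have h₁ := hm' (max m m') (le_max_right _ _)
  obtain ⟨hk, -⟩ := List.getElem?_eq_some_iff.1 hb
  have h₂ := List.prefix_iff_getElem?.1 (M.mono _ _ (initSeg_prefix p (le_max_left m m'))) k hk
  rw [← List.getElem?_eq_getElem hk, hb] at h₂
  simpa [h₁] using h₂

/-- The partial function on Cantor space that is computed by the machine `M`. -/
noncomputable def TypeTwoMachine.toPFun (M : TypeTwoMachine) : Cantor →. Cantor := fun p =>
  ⟨∃ q, M.Writes p q, fun h => h.choose⟩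

theorem TypeTwoMachine.mem_toPFun {M : TypeTwoMachine} {p q : Cantor} :
    q ∈ M.toPFun p ↔ M.Writes p q :=
  ⟨fun ⟨h, e⟩ => e ▸ h.choose_spec, fun h => ⟨⟨q, h⟩, (Exists.choose_spec ⟨q, h⟩).unique h⟩⟩

theorem TypeTwoMachine.isComputable_toPFun (M : TypeTwoMachine) : IsComputable M.toPFun :=
  ⟨M, fun _ _ => mem_toPFun⟩

/-- The composition of two machines: first `N`, then `M`. -/
def TypeTwoMachine.comp (M N : TypeTwoMachine) : TypeTwoMachine where
  out w := M.out (N.out w)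
  computable := M.computable.comp N.computable
  mono w v h := M.mono _ _ (N.mono w v h)

theorem TypeTwoMachine.comp_writes {M N : TypeTwoMachine} {p q r : Cantor} (hN : N.Writes p q)
    (hM : M.Writes q r) : (M.comp N).Writes p r := fun n => by
  obtain ⟨k, hk⟩ := hM n
  obtain ⟨m, hm⟩ := hN k
  exact ⟨m, hk.trans (M.mono _ _ hm)⟩

/-! ### Machines that guess and verify -/

/-- The value of the first of `g 0, …, g (n - 1)` that is defined. -/
def firstDefined (g : ℕ → Option Bool) : ℕ → Option Bool
  | 0 => none
  | n + 1 => Option.casesOn (firstDefined g n) (g n) some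

theorem firstDefined_eq_rec (g : ℕ → Option Bool) (n : ℕ) :
    firstDefined g n = Nat.rec (motive := fun _ => Option Bool) none
      (fun m o => Option.casesOn o (g m) some) n := by
  induction n with
  | zero => rfl
  | succ n ih => rw [firstDefined, ih]

theorem firstDefined_eq_some {g : ℕ → Option Bool} {b : Bool} :
    ∀ {n}, firstDefined g n = some b → ∃ m < n, g m = some b
  | n + 1, h => by
    rw [firstDefined] at h
    cases hn : firstDefined g n with
    | none => exact ⟨n, n.lt_succ_self, by simpa [hn] using h⟩
    | some c =>
      obtain ⟨m, hm, e⟩ := firstDefined_eq_some hn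
      exact ⟨m, hm.trans n.lt_succ_self, by rw [hn] at h; exact e.trans h⟩

theorem firstDefined_mono {g : ℕ → Option Bool} {b : Bool} {n n' : ℕ} (h : n ≤ n')
    (hn : firstDefined g n = some b) : firstDefined g n' = some b := by
  induction n', h using Nat.le_induction with
  | base => exact hn
  | succ k _ ih => rw [firstDefined, ih]

theorem firstDefined_congr {g g' : ℕ → Option Bool} :
    ∀ {n}, (∀ m < n, g m = g' m) → firstDefined g n = firstDefined g' n
  | 0, _ => rfl
  | n + 1, h => by
    rw [firstDefined, firstDefined, h n n.lt_succ_self,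
      firstDefined_congr fun m hm => h m (hm.trans n.lt_succ_self)]

theorem isSome_firstDefined {g : ℕ → Option Bool} {m : ℕ} (h : (g m).isSome) :
    (firstDefined g (m + 1)).isSome := by
  rw [firstDefined]
  cases firstDefined g m <;> simp [h]

/-- The longest word of length at most `n` whose `j`-th symbol is `h j`. -/
def definedPart (h : ℕ → Option Bool) : ℕ → List Bool
  | 0 => []
  | n + 1 => bif (definedPart h n).length == n then
      Option.casesOn (h n) (definedPart h n) (fun b => definedPart h n ++ [b])
    else definedPart h n

theorem definedPart_eq_rec (h : ℕ → Option Bool) (n : ℕ) :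
    definedPart h n = Nat.rec (motive := fun _ => List Bool) []
      (fun n l => bif l.length == n then Option.casesOn (h n) l (fun b => l ++ [b]) else l) n := by
  induction n with
  | zero => rfl
  | succ n ih => rw [definedPart, ih]

theorem definedPart_prefix_succ (h : ℕ → Option Bool) (n : ℕ) :
    definedPart h n <+: definedPart h (n + 1) := by
  rw [definedPart]
  cases (definedPart h n).length == n
  · exact List.prefix_refl _
  · cases h n
    · exact List.prefix_refl _
    · exact List.prefix_append _ _

theorem length_definedPart_le (h : ℕ → Option Bool) (n : ℕ) : (definedPart h n).length ≤ n := by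
  induction n with
  | zero => simp [definedPart]
  | succ n ih =>
    rw [definedPart]
    cases (definedPart h n).length == n
    · exact ih.trans n.le_succ
    · cases h n
      · exact ih.trans n.le_succ
      · simpa using ih

theorem definedPart_mono {h h' : ℕ → Option Bool} (hh : ∀ j b, h j = some b → h' j = some b)
    {n n' : ℕ} (hn : n ≤ n') : definedPart h n <+: definedPart h' n' := by
  have key : ∀ n, definedPart h n <+: definedPart h' n := by
    intro n
    induction n with
    | zero => exact List.prefix_refl _
    | succ n ih =>
      by_cases hl : (definedPart h n).length = n
      · have e : definedPart h n = definedPart h' n :=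
          ih.eq_of_length_le (hl.symm ▸ length_definedPart_le h' n)
        cases hb : h n with
        | none =>
          have : definedPart h (n + 1) = definedPart h n := by simp [definedPart, hb]
          rw [this]
          exact ih.trans (definedPart_prefix_succ h' n)
        | some b => simp [definedPart, ← e, hb, hh n b hb]
      · have : definedPart h (n + 1) = definedPart h n := by
          rw [definedPart, beq_eq_false_iff_ne.2 hl, cond_false]
        rw [this]
        exact ih.trans (definedPart_prefix_succ h' n)
  refine (key n).trans ?_
  induction n', hn using Nat.le_induction with
  | base => exact List.prefix_refl _
  | succ k _ ih => exact ih.trans (definedPart_prefix_succ h' k)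

theorem definedPart_eq_initSeg {h : ℕ → Option Bool} {q : Cantor} {n : ℕ}
    (hq : ∀ j < n, h j = some (q j)) : definedPart h n = initSeg q n := by
  induction n with
  | zero => rfl
  | succ n ih =>
    rw [definedPart, ih fun j hj => hq j (hj.trans n.lt_succ_self)]
    simp [hq n n.lt_succ_self, initSeg_length]
    simp [initSeg, List.range_succ]

/-- The machine whose `j`-th output symbol is the first value `g v j` that is defined for an initial
segment `v` of the input. Since `g` has the whole word at its disposal, it can take the length of
the word as a guess, of a witness or of a part of the input, which it need only verify. -/
def TypeTwoMachine.ofBits (g : List Bool → ℕ → Option Bool) (hg : Computable₂ g) :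
    TypeTwoMachine where
  out w := definedPart (fun j => firstDefined (fun m => g (w.take m) j) (w.length + 1)) w.length
  computable := by
    have hfirst : Computable₂ fun (w : List Bool) (j : ℕ) =>
        firstDefined (fun m => g (w.take m) j) (w.length + 1) := by
      have h : Computable fun z : List Bool × ℕ => Nat.rec (motive := fun _ => Option Bool) none
          (fun m o => Option.casesOn o (g (z.1.take m) z.2) some) (z.1.length + 1) := by
        refine Computable.nat_rec
          (Computable.succ.comp (Computable.list_length.comp Computable.fst))
          (Computable.const none) (Computable.option_casesOn
            (Computable.snd.comp Computable.snd) (hg.comp (Primrec.list_take.to_comp.comp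
              (Computable.fst.comp Computable.snd) (Computable.fst.comp Computable.fst))
              (Computable.snd.comp Computable.fst))
            (Computable.option_some.comp Computable.snd).to₂).to₂
      exact h.of_eq fun z =>
        (firstDefined_eq_rec (fun m => g (z.1.take m) z.2) (z.1.length + 1)).symm
    have h : Computable fun w : List Bool => Nat.rec (motive := fun _ => List Bool) []
        (fun n l => bif l.length == n then
          Option.casesOn (firstDefined (fun m => g (w.take m) n) (w.length + 1)) l
            (fun b => l ++ [b]) else l) w.length := by
      have hl : Computable fun z : List Bool × ℕ × List Bool => z.2.2 :=
        Computable.snd.comp Computable.snd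
      have hn : Computable fun z : List Bool × ℕ × List Bool => z.2.1 :=
        Computable.fst.comp Computable.snd
      refine Computable.nat_rec Computable.list_length (Computable.const [])
        (Computable.cond (Primrec.beq.to_comp.comp (Computable.list_length.comp hl) hn)
          (Computable.option_casesOn (hfirst.comp Computable.fst hn) hl
            (Computable.list_concat.comp (hl.comp Computable.fst) Computable.snd).to₂) hl).to₂
    exact h.of_eq fun w => (definedPart_eq_rec _ _).symm
  mono w v h := by
    refine definedPart_mono (fun j b hb => ?_) h.length_le
    refine firstDefined_mono (Nat.succ_le_succ h.length_le) ?_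
    rw [← hb]
    refine firstDefined_congr fun m hm => ?_
    rw [List.prefix_iff_eq_take.1 h, List.take_take, min_eq_left (Nat.lt_succ_iff.1 hm)]

theorem TypeTwoMachine.ofBits_writes {g : List Bool → ℕ → Option Bool} (hg : Computable₂ g)
    {p q : Cantor} (sound : ∀ m j b, g (initSeg p m) j = some b → b = q j)
    (complete : ∀ j, ∃ m, (g (initSeg p m) j).isSome) : (ofBits g hg).Writes p q := by
  intro n
  choose μ hμ using complete
  obtain ⟨m, hm, hnm⟩ : ∃ m, (∀ j < n, μ j ≤ m) ∧ n ≤ m :=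
    ⟨(Finset.range n).sup μ + n, fun j hj => (Finset.le_sup (f := μ) (Finset.mem_range.2 hj)).trans
      (Nat.le_add_right _ _), Nat.le_add_left _ _⟩
  refine ⟨m, ?_⟩
  have key : ∀ j < n, firstDefined (fun k => g ((initSeg p m).take k) j)
      ((initSeg p m).length + 1) = some (q j) := by
    intro j hj
    rw [initSeg_length]
    have h₁ := isSome_firstDefined (g := fun k => g ((initSeg p m).take k) j) (m := μ j)
      (by rw [take_initSeg p (hm j hj)]; exact hμ j)
    obtain ⟨b, hb⟩ := Option.isSome_iff_exists.1 h₁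
    obtain ⟨k, hk, e⟩ := firstDefined_eq_some hb
    rw [take_initSeg p (by have := hm j hj; omega)] at e
    rw [← sound k j b e]
    exact firstDefined_mono (Nat.succ_le_succ (hm j hj)) hb
  rw [← definedPart_eq_initSeg key]
  exact definedPart_mono (fun _ _ h => h) (by rwa [initSeg_length])

/-- A function on Cantor space with a computable modulus of continuity, whose values on padded words
are computable, is computed by a machine. -/
theorem exists_machine_of_modulus {F : Cantor → Cantor} {β : ℕ → ℕ} (hβ : Computable β)
    (hF : Computable₂ fun w => F (pad w))
    (hmod : ∀ p q j, (∀ k < β j, p k = q k) → F p j = F q j) :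
    ∃ M : TypeTwoMachine, ∀ p, M.Writes p (F p) := by
  have hg : Computable₂ fun (w : List Bool) (j : ℕ) =>
      bif decide (β j ≤ w.length) then some (F (pad w) j) else none :=
    Computable.cond (Primrec.nat_le.decide.to_comp.comp (hβ.comp Computable.snd)
      (Computable.list_length.comp Computable.fst)) (Computable.option_some.comp hF)
      (Computable.const none)
  refine ⟨TypeTwoMachine.ofBits _ hg, fun p => TypeTwoMachine.ofBits_writes hg ?_ ?_⟩
  · intro m j b h
    rw [initSeg_length] at h
    by_cases hm : β j ≤ m
    · rw [decide_eq_true hm, cond_true, Option.some_inj] at h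
      rw [← h]
      exact hmod _ _ j fun k hk => pad_initSeg (hk.trans_le hm)
    · simp [hm] at h
  · intro j
    exact ⟨β j, by simp [initSeg_length]⟩

/-! ### Codes of realizers -/

/-- A code, in the sense of `UnivWrites`, of the function `p ↦ M ⟨q, p⟩`: it demands that `v` is
written on inputs starting with `w` if `M` has written `v` after reading the first `|w|` symbols of
both `q` and `w`. -/
def sectionCode (M : TypeTwoMachine) (q : Cantor) : Cantor := fun j =>
  Option.casesOn (Encodable.decode (α := List Bool × List Bool) j) false fun z =>
    decide ((M.out (initSeg (pair q (pad z.1)) (2 * z.1.length))).take z.2.length = z.2)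

theorem sectionCode_encode (M : TypeTwoMachine) (q p : Cantor) (m : ℕ) (v : List Bool) :
    sectionCode M q (Encodable.encode (initSeg p m, v)) = true ↔
      v <+: M.out (initSeg (pair q p) (2 * m)) := by
  rw [sectionCode, Encodable.encodek]
  simp only [initSeg_length]
  rw [initSeg_pair_congr (fun _ _ => rfl) fun k hk => pad_initSeg hk, decide_eq_true_iff,
    List.prefix_iff_eq_take, eq_comm]

theorem univWrites_sectionCode {M : TypeTwoMachine} {q p r : Cantor}
    (h : M.Writes (pair q p) r) : UnivWrites (sectionCode M q) p r := by
  refine ⟨fun n => ?_, fun m v hv => h.prefix ((sectionCode_encode _ _ _ _ _).1 hv)⟩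
  obtain ⟨m, hm⟩ := h n
  exact ⟨m, (sectionCode_encode _ _ _ _ _).2
    (hm.trans (M.mono _ _ (initSeg_prefix _ (Nat.le_mul_of_pos_left m two_pos))))⟩

/-- The modulus of continuity of `sectionCode`. -/
def sectionModulus (j : ℕ) : ℕ :=
  Option.casesOn (Encodable.decode (α := List Bool × List Bool) j) 0 fun z => z.1.length

theorem computable_sectionModulus : Computable sectionModulus :=
  Computable.option_casesOn Computable.decode (Computable.const 0)
    (Computable.list_length.comp (Computable.fst.comp Computable.snd)).to₂

theorem sectionCode_congr (M : TypeTwoMachine) {p q : Cantor} {j : ℕ}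
    (h : ∀ k < sectionModulus j, p k = q k) : sectionCode M p j = sectionCode M q j := by
  rw [sectionModulus] at h
  rw [sectionCode, sectionCode]
  cases hj : Encodable.decode (α := List Bool × List Bool) j with
  | none => rfl
  | some z =>
    rw [hj] at h
    dsimp only at h ⊢
    rw [initSeg_pair_congr h fun _ _ => rfl]

theorem computable_sectionCode (M : TypeTwoMachine) :
    Computable₂ fun w => sectionCode M (pad w) := by
  have hw : Computable fun a : (List Bool × ℕ) × List Bool × List Bool => a.2.1 :=
    Computable.fst.comp Computable.snd
  have hv : Computable fun a : (List Bool × ℕ) × List Bool × List Bool => a.2.2 :=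
    Computable.snd.comp Computable.snd
  have hu : Computable fun a : (List Bool × ℕ) × List Bool × List Bool => a.1.1 :=
    Computable.fst.comp Computable.fst
  have hp : Computable₂ fun a : (List Bool × ℕ) × List Bool × List Bool =>
      pair (pad a.1.1) (pad a.2.1) :=
    computable_pair (computable_pad.comp (hu.comp Computable.fst) Computable.snd)
      (computable_pad.comp (hw.comp Computable.fst) Computable.snd)
  have hn : Computable fun a : (List Bool × ℕ) × List Bool × List Bool => 2 * a.2.1.length :=
    Primrec.nat_mul.to_comp.comp (Computable.const 2) (Computable.list_length.comp hw)
  have ho := M.computable.comp (computable_initSeg hp hn)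
  have ht := Primrec.list_take.to_comp.comp (Computable.list_length.comp hv) ho
  have hb := Primrec.eq.decide.to_comp.comp ht hv
  exact Computable.option_casesOn (Computable.decode.comp Computable.snd)
    (Computable.const false) hb.to₂

theorem exists_machine_sectionCode (M : TypeTwoMachine) :
    ∃ N : TypeTwoMachine, ∀ p, N.Writes p (sectionCode M p) :=
  exists_machine_of_modulus computable_sectionModulus (computable_sectionCode M)
    fun _ _ _ => sectionCode_congr M

theorem exists_machine_pair_sectionCode (M N : TypeTwoMachine) :
    ∃ L : TypeTwoMachine, ∀ p, L.Writes p (pair (sectionCode M p) (sectionCode N p)) := by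
  refine exists_machine_of_modulus (β := fun j => sectionModulus (j / 2))
    (computable_sectionModulus.comp
      (Primrec.nat_div.comp Primrec.id (Primrec.const 2)).to_comp)
    (computable_pair (computable_sectionCode M) (computable_sectionCode N)) fun p q j h => ?_
  simp only [pair, sectionCode_congr _ h]

/-! ### Names of numbers, of sequences, and of points of a computable metric space -/

/-- The name of a natural number. -/
def natName (n : ℕ) : Cantor := fun m => decide (m = n)

theorem names_natRep_iff {p : Cantor} {n : ℕ} : natRep.Names p n ↔ p = natName n := by
  constructor
  · intro h
    funext m
    rw [natName, Bool.eq_iff_iff, h m, decide_eq_true_iff]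
  · rintro rfl m
    simp [natName]

/-- The join of the names of the members of a sequence of natural numbers. -/
def seqName (s : ℕ → ℕ) : Cantor := fun k => decide (k.unpair.2 = s k.unpair.1)

theorem ComputableMetric.names_iff {X : Type*} [MetricSpace X] {c : ComputableMetric X}
    {p : Cantor} {x : X} :
    c.cauchyRep.Names p x ↔ ∃ s, p = seqName s ∧ ∀ k, dist (c.pt (s k)) x ≤ 1 / 2 ^ k := by
  constructor
  · rintro ⟨s, hs, hx⟩
    refine ⟨s, funext fun k => ?_, hx⟩
    have := congrFun (names_natRep_iff.1 (hs k.unpair.1)) k.unpair.2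
    simpa [natName, seqName] using this
  · rintro ⟨s, rfl, hx⟩
    exact ⟨s, fun k => names_natRep_iff.2 (by funext m; simp [seqName, natName]), hx⟩

theorem computable_natName : Computable₂ natName :=
  (Primrec.eq.decide.comp Primrec.snd Primrec.fst).to_comp

/-- The first `n` members of a sequence of natural numbers. -/
def seqSeg (s : ℕ → ℕ) (n : ℕ) : List ℕ := (List.range n).map s

theorem length_seqSeg (s : ℕ → ℕ) (n : ℕ) : (seqSeg s n).length = n := by simp [seqSeg]

theorem seqSeg_prefix (s : ℕ → ℕ) {m n : ℕ} (h : m ≤ n) : seqSeg s m <+: seqSeg s n := by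
  obtain ⟨k, rfl⟩ := Nat.exists_eq_add_of_le h
  simp [seqSeg, List.range_add]

/-- The `k`-th entry of a finite sequence of natural numbers. -/
def entry (t : List ℕ) (k : ℕ) : ℕ := t.getD k 0

theorem entry_seqSeg {s : ℕ → ℕ} {n k : ℕ} (h : k < n) : entry (seqSeg s n) k = s k := by
  simp [entry, seqSeg, h]

theorem entry_of_prefix {t t' : List ℕ} (h : t <+: t') {k : ℕ} (hk : k < t.length) :
    entry t' k = entry t k := by
  obtain ⟨r, rfl⟩ := h
  simp [entry, List.getElem?_append_left hk]

theorem eq_seqSeg {t : List ℕ} {s : ℕ → ℕ} (h : ∀ k < t.length, entry t k = s k) :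
    t = seqSeg s t.length := by
  refine List.ext_getElem (length_seqSeg _ _).symm fun k h₁ h₂ => ?_
  have := h k h₁
  simp only [entry, List.getD_eq_getElem _ _ h₁] at this
  simpa [seqSeg] using this

theorem seqName_congr {s s' : ℕ → ℕ} {n k : ℕ} (h : ∀ i < n, s i = s' i) (hk : k < n) :
    seqName s k = seqName s' k := by
  rw [seqName, seqName, h _ ((Nat.unpair_left_le k).trans_lt hk)]

theorem computable_entry : Computable₂ entry := (Primrec.list_getD 0).to_comp

/-! ### Reductions to closed choice on the natural numbers -/

theorem isClosedName_natRep {u : Cantor} {B : Set ℕ} (h : IsClosedName natRep u B) {n : ℕ} :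
    n ∉ B ↔ ∃ m v, pad v (v.length - 1) = true ∧
      u (Encodable.encode (initSeg (natName n) m, v)) = true := by
  obtain ⟨q, hq, hn⟩ := h (natName n) n (names_natRep_iff.2 rfl)
  refine hn.trans ⟨?_, ?_⟩
  · rintro ⟨j, hj⟩
    obtain ⟨m, hm⟩ := hq.1 (j + 1)
    refine ⟨m, _, ?_, hm⟩
    rw [initSeg_length, Nat.add_sub_cancel, pad_initSeg j.lt_succ_self, hj]
  · rintro ⟨m, v, hv, hu⟩
    rw [hq.2 m v hu] at hv
    exact ⟨_, eq_true_of_pad_initSeg hv⟩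

/-- `H` and `K` witness that the total function `f` is Weihrauch reducible to closed choice on the
natural numbers: on names `p` of points `x`, the machine `K` writes a name of a nonempty set, each
of whose members allows `H` to find a name of `f x`. -/
def IsChoiceReduction {X Y : Type*} (δX : CantorRep X) (δY : CantorRep Y) (f : X → Y)
    (H K : TypeTwoMachine) : Prop :=
  ∀ p x, δX.Names p x → ∃ u B, K.Writes p u ∧ IsClosedName natRep u B ∧ B.Nonempty ∧
    ∀ n ∈ B, ∃ q, H.Writes (pair p (natName n)) q ∧ δY.Names q (f x)

theorem exists_isChoiceReduction {X Y : Type*} {δX : CantorRep X} {δY : CantorRep Y} {f : X → Y}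
    (hf : WeihrauchReducible δX δY (closedRep natRep) natRep (fun x => {f x})
      (closedChoice natRep)) : ∃ H K, IsChoiceReduction δX δY f H K := by
  classical
  obtain ⟨H, K, ⟨MH, hMH⟩, ⟨MK, hMK⟩, hred⟩ := hf
  refine ⟨MH, MK, fun p x hp => ?_⟩
  -- For any choice function `e`, the realizer of closed choice with domain exactly the names of
  -- nonempty sets that selects by means of `e`.
  let G (e : ClosedSet natRep → ℕ) : Cantor →. Cantor := fun u =>
    ⟨∃ A : ClosedSet natRep, (closedRep natRep).Names u A ∧ A.1.Nonempty,
      fun h => natName (e h.choose)⟩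
  have hG : ∀ e : ClosedSet natRep → ℕ, (∀ A, A.1.Nonempty → e A ∈ A.1) →
      Realizes (closedRep natRep) natRep (G e) (closedChoice natRep) := by
    intro e he u A hu hA
    have hd : ∃ A : ClosedSet natRep, (closedRep natRep).Names u A ∧ A.1.Nonempty :=
      ⟨A, hu, hA⟩
    have hAe : hd.choose = A := (closedRep natRep).unique hd.choose_spec.1 hu
    refine ⟨natName (e A), ⟨hd, ?_⟩, e A, he A hA, names_natRep_iff.2 rfl⟩
    change natName (e hd.choose) = _
    rw [hAe]
  have key : ∀ e : ClosedSet natRep → ℕ, (∀ A, A.1.Nonempty → e A ∈ A.1) →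
      ∃ u, u ∈ K p ∧ ∃ A : ClosedSet natRep, IsClosedName natRep u A.1 ∧ A.1.Nonempty ∧
        ∃ q, MH.Writes (pair p (natName (e A))) q ∧ δY.Names q (f x) := by
    intro e he
    obtain ⟨q, hq, y, rfl, hy⟩ := hred (G e) (hG e he) p x hp ⟨f x, rfl⟩
    obtain ⟨u, hu, hq⟩ := Part.mem_bind_iff.1 hq
    obtain ⟨v, ⟨hd, rfl⟩, hq⟩ := Part.mem_bind_iff.1 hq
    exact ⟨u, hu, hd.choose, hd.choose_spec.1, hd.choose_spec.2, q, (hMH _ _).1 hq, hy⟩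
  let e₀ : ClosedSet natRep → ℕ := fun A => if h : A.1.Nonempty then h.choose else 0
  have he₀ : ∀ A : ClosedSet natRep, A.1.Nonempty → e₀ A ∈ A.1 := fun A h => by
    simp only [e₀, dif_pos h]
    exact h.choose_spec
  obtain ⟨u, hu, A, huA, hA, -⟩ := key e₀ he₀
  refine ⟨u, A.1, (hMK _ _).1 hu, huA, hA, fun n hn => ?_⟩
  obtain ⟨u', hu', A', huA', -, q, hq, hqx⟩ := key (Function.update e₀ A n) fun A' hA' => by
    by_cases h : A' = A
    · subst h
      simpa using hn
    · simpa [h] using he₀ A' hA'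
  obtain rfl := Part.mem_unique hu hu'
  obtain rfl : A = A' := Subtype.ext (huA.unique huA')
  exact ⟨q, by simpa using hq, hqx⟩

/-! ### The pieces -/

/-- After reading the names of `q` and of a sequence that starts with `t`, as far as `t` determines
the latter, the machine `K` has excluded the number `n` from the closed set it is naming. -/
def Rejects (K : TypeTwoMachine) (q : Cantor) (n : ℕ) (t : List ℕ) : Prop :=
  ∃ m v, pad v (v.length - 1) = true ∧
    (K.out (initSeg (pair (seqName (entry t)) q) (2 * t.length)))[Encodable.encode
      (initSeg (natName n) m, v)]? = some true

theorem Rejects.notMem {K : TypeTwoMachine} {q u : Cantor} {s : ℕ → ℕ} {B : Set ℕ} {n : ℕ}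
    {t : List ℕ} (h : Rejects K q n t) (hu : K.Writes (pair (seqName s) q) u)
    (hB : IsClosedName natRep u B) (ht : ∀ k < t.length, entry t k = s k) : n ∉ B := by
  obtain ⟨m, v, hv, ho⟩ := h
  rw [initSeg_pair_congr (fun k hk => seqName_congr ht hk) fun _ _ => rfl] at ho
  exact (isClosedName_natRep hB).2 ⟨m, v, hv, hu.eq_of_getElem? ho⟩

theorem exists_rejects {K : TypeTwoMachine} {q u : Cantor} {s : ℕ → ℕ} {B : Set ℕ} {n : ℕ}
    (hn : n ∉ B) (hu : K.Writes (pair (seqName s) q) u) (hB : IsClosedName natRep u B) :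
    ∃ l, ∀ l' ≥ l, Rejects K q n (seqSeg s l') := by
  obtain ⟨m, v, hv, huv⟩ := (isClosedName_natRep hB).1 hn
  obtain ⟨l, hl⟩ := hu.exists_getElem? (Encodable.encode (initSeg (natName n) m, v))
  refine ⟨l, fun l' hl' => ⟨m, v, hv, ?_⟩⟩
  rw [length_seqSeg, initSeg_pair_congr (fun k hk => seqName_congr (fun i hi => entry_seqSeg hi) hk)
    fun _ _ => rfl, hl _ (by omega), huv]

/-- The sequence that starts with `t` and continues with the sequence `s` shifted by one. -/
def graft (t : List ℕ) (s : ℕ → ℕ) : ℕ → ℕ := fun k =>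
  if k < t.length then entry t k else s (k + 1)

section Pieces

variable {X : Type*} [MetricSpace X] (c : ComputableMetric X)

/-- The finite sequence `t` of indices begins a name of `x`, with strict inequalities: unlike the
weak ones in the Cauchy representation, these define an open set of points `x`. -/
def ComputableMetric.Approximates (t : List ℕ) (x : X) : Prop :=
  ∀ k < t.length, dist (c.pt (entry t k)) x < 1 / 2 ^ k

/-- The piece with index `(t, n, m)`, a closed set: its points are those `x` of which `t` begins a
name, with a margin of `2 ^ (-m)`, while `K` never excludes `n` on a name of `x` that extends `t` and
satisfies strict inequalities. -/
def ComputableMetric.piece (K : TypeTwoMachine) (q : Cantor) (i : List ℕ × ℕ × ℕ) : Set X :=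
  {x | (∀ k < i.1.length, dist (c.pt (entry i.1 k)) x + 1 / 2 ^ i.2.2 ≤ 1 / 2 ^ k) ∧
    ∀ t, i.1 <+: t → c.Approximates t x → ¬ Rejects K q i.2.1 t}

variable {c}

theorem eventually_forall_lt_add_le {n : ℕ} {a b : ℕ → ℝ} (C : ℝ) (h : ∀ k < n, a k < b k) :
    ∀ᶠ m : ℕ in Filter.atTop, ∀ k < n, a k + C / 2 ^ m < b k := by
  have h0 : Filter.Tendsto (fun m : ℕ => C / 2 ^ m) Filter.atTop (nhds 0) := by
    simpa [div_eq_mul_inv] using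
      (tendsto_pow_atTop_nhds_zero_of_lt_one (r := (2 : ℝ)⁻¹) (by norm_num)
        (by norm_num)).const_mul C
  refine (Set.finite_lt_nat n).eventually_all.2 fun k hk => ?_
  filter_upwards [h0.eventually_lt_const (sub_pos.2 (h k hk))] with m hm
  linarith

theorem one_div_two_pow_succ_lt (k : ℕ) : (1 : ℝ) / 2 ^ (k + 1) < 1 / 2 ^ k :=
  one_div_lt_one_div_of_lt (by positivity) (pow_lt_pow_right₀ one_lt_two k.lt_succ_self)

theorem dist_graft_lt {K : TypeTwoMachine} {q : Cantor} {i : List ℕ × ℕ × ℕ} {x : X}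
    (hx : x ∈ c.piece K q i) {s : ℕ → ℕ} (hs : ∀ k, dist (c.pt (s k)) x ≤ 1 / 2 ^ k) (k : ℕ) :
    dist (c.pt (graft i.1 s k)) x < 1 / 2 ^ k := by
  rw [graft]
  split_ifs with h
  · have := hx.1 k h
    have hm : (0 : ℝ) < 1 / 2 ^ i.2.2 := by positivity
    linarith
  · exact (hs _).trans_lt (one_div_two_pow_succ_lt k)

theorem mem_of_mem_piece {K : TypeTwoMachine} {q u : Cantor} {i : List ℕ × ℕ × ℕ} {x : X}
    (hx : x ∈ c.piece K q i) {s : ℕ → ℕ} (hs : ∀ k, dist (c.pt (s k)) x ≤ 1 / 2 ^ k) {B : Set ℕ}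
    (hu : K.Writes (pair (seqName (graft i.1 s)) q) u) (hB : IsClosedName natRep u B) :
    i.2.1 ∈ B := by
  by_contra hn
  obtain ⟨l, hl⟩ := exists_rejects hn hu hB
  refine hx.2 (seqSeg (graft i.1 s) (max l i.1.length)) ?_ ?_ (hl _ (le_max_left _ _))
  · have hp := seqSeg_prefix (graft i.1 s) (le_max_right l i.1.length)
    rwa [← eq_seqSeg fun k hk => by rw [graft, if_pos hk]] at hp
  · intro k hk
    rw [length_seqSeg] at hk
    rw [entry_seqSeg hk]
    exact dist_graft_lt hx hs k

/-- The pieces cover the space, if `K` names a nonempty set on any name of a point. For otherwise,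
as in the proof of the Baire category theorem, a name on which `K` excludes every number can be
constructed, by extending in the `n`-th step a finite sequence to one on which `n` is excluded. -/
theorem exists_mem_piece {K : TypeTwoMachine} {q : Cantor} {x : X}
    (h : ∀ s : ℕ → ℕ, (∀ k, dist (c.pt (s k)) x ≤ 1 / 2 ^ k) →
      ∃ u B, K.Writes (pair (seqName s) q) u ∧ IsClosedName natRep u B ∧ B.Nonempty) :
    ∃ i, x ∈ c.piece K q i := by
  by_contra! hno
  have step : ∀ (t : {t // c.Approximates t x}) (n : ℕ),
      ∃ t' : {t // c.Approximates t x}, t.1 <+: t'.1 ∧ Rejects K q n t'.1 := by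
    rintro ⟨t, ht⟩ n
    obtain ⟨m, hm⟩ := (eventually_forall_lt_add_le 1 ht).exists
    by_contra! hr
    exact hno (t, n, m) ⟨fun k hk => (hm k hk).le, fun t' htt' ht' => hr ⟨t', ht'⟩ htt'⟩
  have grow : ∀ t : {t // c.Approximates t x},
      ∃ t' : {t // c.Approximates t x}, t.1 <+: t'.1 ∧ t.1.length < t'.1.length := by
    rintro ⟨t, ht⟩
    obtain ⟨a, ha⟩ := c.dense.exists_dist_lt x (ε := 1 / 2 ^ t.length) (by positivity)
    refine ⟨⟨t ++ [a], fun k hk => ?_⟩, List.prefix_append _ _, by simp⟩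
    rcases Nat.lt_succ_iff_lt_or_eq.1 (by simpa using hk) with hk | rfl
    · rw [entry_of_prefix (List.prefix_append _ _) hk]
      exact ht k hk
    · simpa [entry, dist_comm] using ha
  have both : ∀ (t : {t // c.Approximates t x}) (n : ℕ), ∃ t' : {t // c.Approximates t x},
      t.1 <+: t'.1 ∧ t.1.length < t'.1.length ∧ Rejects K q n t'.1 := fun t n => by
    obtain ⟨t₁, h₁, hl⟩ := grow t
    obtain ⟨t₂, h₂, hr⟩ := step t₁ n
    exact ⟨t₂, h₁.trans h₂, hl.trans_le h₂.length_le, hr⟩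
  choose e he_prefix he_length he_rejects using both
  let T : ℕ → {t // c.Approximates t x} := fun n =>
    Nat.rec ⟨[], fun k hk => absurd hk (Nat.not_lt_zero k)⟩ (fun n t => e t n) n
  have hT_length : ∀ n, n ≤ (T n).1.length := by
    intro n
    induction n with
    | zero => exact Nat.zero_le _
    | succ n ih => exact ih.trans_lt (he_length (T n) n)
  have hT : ∀ {m n}, m ≤ n → (T m).1 <+: (T n).1 := by
    intro m n hmn
    induction n, hmn using Nat.le_induction with
    | base => exact List.prefix_refl _
    | succ n _ ih => exact ih.trans (he_prefix (T n) n)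
  let s : ℕ → ℕ := fun k => entry (T (k + 1)).1 k
  have hs : ∀ n, ∀ k < (T n).1.length, entry (T n).1 k = s k := by
    intro n k hk
    rcases le_total n (k + 1) with h | h
    · exact (entry_of_prefix (hT h) hk).symm
    · exact entry_of_prefix (hT h) (hT_length (k + 1))
  obtain ⟨u, B, hu, hB, n, hn⟩ := h s fun k => ((T (k + 1)).2 k (hT_length (k + 1))).le
  exact (he_rejects (T n) n).notMem hu hB (hs (n + 1)) hn

/-! ### Comparing distances with dyadic numbers -/

/-- If the `a`-th point approximates `x` up to `2 ^ (-l)`, then `D (i, a, l) / 2 ^ l` approximates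
the distance from the `i`-th point to `x` up to `2 * 2 ^ (-l)`. -/
def ComputableMetric.HasBounds (c : ComputableMetric X) (D : ℕ × ℕ × ℕ → ℕ) : Prop :=
  ∀ i a l x, dist (c.pt a) x ≤ 1 / 2 ^ l →
    (D (i, a, l) : ℝ) / 2 ^ l ≤ dist (c.pt i) x + 2 / 2 ^ l ∧
    dist (c.pt i) x ≤ (D (i, a, l) : ℝ) / 2 ^ l + 2 / 2 ^ l

theorem exists_computable_bounds (c : ComputableMetric X) :
    ∃ D : ℕ × ℕ × ℕ → ℕ, Computable D ∧ c.HasBounds D := by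
  obtain ⟨D, hD, h⟩ := c.computable_dist
  refine ⟨D, hD, fun i a l x hx => ?_⟩
  have h₁ := abs_le.1 (h i a l)
  have h₂ := dist_triangle (c.pt i) (c.pt a) x
  have h₃ := dist_triangle_right (c.pt i) (c.pt a) x
  have h₄ : (2 : ℝ) / 2 ^ l = 1 / 2 ^ l + 1 / 2 ^ l := by ring
  constructor <;> linarith [h₁.1, h₁.2]

/-- The inequality `2 ^ (-k) < (d - 2) * 2 ^ (-l) + 2 ^ (-m)` in terms of natural numbers. -/
theorem far_iff {d k l m : ℕ} :
    2 * 2 ^ (k + m) + 2 ^ (l + m) < d * 2 ^ (k + m) + 2 ^ (l + k) ↔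
      (1 : ℝ) / 2 ^ k < d / 2 ^ l - 2 / 2 ^ l + 1 / 2 ^ m := by
  have e : ((d : ℝ) / 2 ^ l - 2 / 2 ^ l + 1 / 2 ^ m - 1 / 2 ^ k) * (2 ^ k * 2 ^ l * 2 ^ m) =
      (d * 2 ^ (k + m) + 2 ^ (l + k)) - (2 * 2 ^ (k + m) + 2 ^ (l + m)) := by
    simp only [pow_add]
    field_simp
    ring
  rw [← Nat.cast_lt (α := ℝ), ← sub_pos, iff_comm, ← sub_pos]
  push_cast
  rw [← e]
  exact (mul_pos_iff_of_pos_right (by positivity)).symm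

/-- The inequality `(d + 2) * 2 ^ (-l) < 2 ^ (-k)` in terms of natural numbers. -/
theorem near_iff {d k l : ℕ} :
    (d + 2) * 2 ^ k < 2 ^ l ↔ (d : ℝ) / 2 ^ l + 2 / 2 ^ l < 1 / 2 ^ k := by
  rw [← add_div, div_lt_div_iff₀ (by positivity) (by positivity), one_mul, ← Nat.cast_lt (α := ℝ)]
  push_cast
  rfl

end Pieces

/-! ### Enumerating the complements of the pieces -/

/-- The indices of the pieces, coded by natural numbers. -/
def pieceIndex (i : ℕ) : List ℕ × ℕ × ℕ := (Encodable.decode i).getD ([], 0, 0)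

theorem pieceIndex_encode (i : List ℕ × ℕ × ℕ) : pieceIndex (Encodable.encode i) = i := by
  rw [pieceIndex, Encodable.encodek, Option.getD_some]

theorem computable_pieceIndex : Computable pieceIndex :=
  Computable.option_getD Computable.decode (Computable.const _)

/-- The `a`-th point, taken as an approximation to `x` up to `2 ^ (-l)`, shows that `x` violates the
`k`-th of the distance conditions in the definition of the piece with index `i`. -/
def farTest (D : ℕ × ℕ × ℕ → ℕ) (i : List ℕ × ℕ × ℕ) (a l k : ℕ) : Bool :=
  decide (k < i.1.length) && decide (2 * 2 ^ (k + i.2.2) + 2 ^ (l + i.2.2) <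
    D (entry i.1 k, a, l) * 2 ^ (k + i.2.2) + 2 ^ (l + k))

/-- The `a`-th point, taken as an approximation to `x` up to `2 ^ (-l)`, shows that `t` begins a
name of `x`, with strict inequalities. -/
def nearTest (D : ℕ × ℕ × ℕ → ℕ) (t : List ℕ) (a l : ℕ) : Bool :=
  (List.range t.length).all fun k => decide ((D (entry t k, a, l) + 2) * 2 ^ k < 2 ^ l)

/-- The pair `(m, v)` witnesses `Rejects K q n t`. -/
def rejectTest (K : TypeTwoMachine) (q : Cantor) (n : ℕ) (t : List ℕ) (m : ℕ) (v : List Bool) :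
    Bool :=
  pad v (v.length - 1) && decide ((K.out (initSeg (pair (seqName (entry t)) q)
    (2 * t.length)))[Encodable.encode (initSeg (natName n) m, v)]? = some true)

/-- The candidates `(i, (a, l), k, t, m, v)` for witnesses that a point does not belong to the
piece with the code `i`: the point is within `2 ^ (-l)` of the `a`-th one, and either `k` passes
`farTest`, or `t` and `(m, v)` pass `nearTest` and `rejectTest`. -/
abbrev Witness : Type := ℕ × (ℕ × ℕ) × ℕ × List ℕ × ℕ × List Bool

/-- The word `w`, a prefix of `⟨⟨q, natName i⟩, p⟩`, confirms the witness `z` for the fact that the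
point with name `p` does not belong to the piece with the code `i`. -/
def outsideTest (K : TypeTwoMachine) (D : ℕ × ℕ × ℕ → ℕ) (w : List Bool) (z : Witness) : Bool :=
  (pad w (2 * (2 * z.1 + 1)) && pad w (2 * Nat.pair z.2.1.2 z.2.1.1 + 1)) &&
    (farTest D (pieceIndex z.1) z.2.1.1 z.2.1.2 z.2.2.1 ||
      ((decide (z.2.2.2.1.take (pieceIndex z.1).1.length = (pieceIndex z.1).1) &&
          decide (4 * z.2.2.2.1.length ≤ w.length)) &&
        (nearTest D z.2.2.2.1 z.2.1.1 z.2.1.2 &&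
          rejectTest K (left (left (pad w))) (pieceIndex z.1).2.1 z.2.2.2.1 z.2.2.2.2.1
            z.2.2.2.2.2)))

/-- The test of the witness that is coded by the first component of the length of the word. -/
def outsideBit (K : TypeTwoMachine) (D : ℕ × ℕ × ℕ → ℕ) (w : List Bool) : Bool :=
  outsideTest K D w ((Encodable.decode w.length.unpair.1).getD (0, (0, 0), 0, [], 0, []))

section Computability

variable {α : Type*} [Primcodable α]

theorem computable_seqName_entry : Computable₂ fun t : List ℕ => seqName (entry t) :=
  Primrec.eq.decide.to_comp.comp (Computable.snd.comp (Computable.unpair.comp Computable.snd))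
    (computable_entry.comp Computable.fst
      (Computable.fst.comp (Computable.unpair.comp Computable.snd)))

theorem computable_farTest {D : ℕ × ℕ × ℕ → ℕ} (hD : Computable D) {i : α → List ℕ × ℕ × ℕ}
    {a l k : α → ℕ} (hi : Computable i) (ha : Computable a) (hl : Computable l)
    (hk : Computable k) : Computable fun z => farTest D (i z) (a z) (l z) (k z) := by
  have ht : Computable fun z => (i z).1 := Computable.fst.comp hi
  have hm : Computable fun z => (i z).2.2 := Computable.snd.comp (Computable.snd.comp hi)
  have hkm := computable_two_pow (computable_add hk hm)
  exact computable_and (computable_lt hk (Computable.list_length.comp ht))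
    (computable_lt (computable_add (computable_mul (Computable.const 2) hkm)
      (computable_two_pow (computable_add hl hm)))
      (computable_add (computable_mul (hD.comp ((computable_entry.comp ht hk).pair (ha.pair hl)))
        hkm) (computable_two_pow (computable_add hl hk))))

theorem computable_nearTest {D : ℕ × ℕ × ℕ → ℕ} (hD : Computable D) {t : α → List ℕ}
    {a l : α → ℕ} (ht : Computable t) (ha : Computable a) (hl : Computable l) :
    Computable fun z => nearTest D (t z) (a z) (l z) := by
  have hk : Computable fun z : α × ℕ => z.2 := Computable.snd
  have hl' : Computable fun z : α × ℕ => l z.1 := hl.comp Computable.fst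
  have hd : Computable fun z : α × ℕ => D (entry (t z.1) z.2, a z.1, l z.1) :=
    hD.comp ((computable_entry.comp (ht.comp Computable.fst) hk).pair
      ((ha.comp Computable.fst).pair hl'))
  exact computable_all_range (computable_lt (computable_mul (computable_add hd
    (Computable.const 2)) (computable_two_pow hk)) (computable_two_pow hl')).to₂
    (Computable.list_length.comp ht)

theorem computable_rejectTest (K : TypeTwoMachine) {q : α → Cantor} {n m : α → ℕ}
    {t : α → List ℕ} {v : α → List Bool} (hq : Computable₂ q) (hn : Computable n)
    (ht : Computable t) (hm : Computable m) (hv : Computable v) :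
    Computable fun z => rejectTest K (q z) (n z) (t z) (m z) (v z) := by
  have h₁ : Computable fun z => pad (v z) ((v z).length - 1) :=
    computable_pad.comp hv (Computable.pred.comp (Computable.list_length.comp hv))
  have hp : Computable₂ fun z => pair (seqName (entry (t z))) (q z) :=
    computable_pair (computable_seqName_entry.comp (ht.comp Computable.fst) Computable.snd) hq
  have ho := K.computable.comp (computable_initSeg hp
    (computable_mul (Computable.const 2) (Computable.list_length.comp ht)))
  have hi : Computable fun z => initSeg (natName (n z)) (m z) :=
    computable_initSeg (computable_natName.comp (hn.comp Computable.fst) Computable.snd) hm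
  have hg := Computable.list_getElem?.comp ho (Computable.encode.comp (hi.pair hv))
  exact computable_and h₁ (Primrec.eq.decide.to_comp.comp hg (Computable.const (some true)))

theorem computable_outsideTest (K : TypeTwoMachine) {D : ℕ × ℕ × ℕ → ℕ} (hD : Computable D) :
    Computable₂ (outsideTest K D) := by
  have hw : Computable fun y : List Bool × Witness => y.1 := Computable.fst
  have hz : Computable fun y : List Bool × Witness => y.2 := Computable.snd
  have hi : Computable fun y : List Bool × Witness => y.2.1 := Computable.fst.comp hz
  have h₁ : Computable fun y : List Bool × Witness => y.2.2 := Computable.snd.comp hz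
  have ha : Computable fun y : List Bool × Witness => y.2.2.1.1 :=
    Computable.fst.comp (Computable.fst.comp h₁)
  have hl : Computable fun y : List Bool × Witness => y.2.2.1.2 :=
    Computable.snd.comp (Computable.fst.comp h₁)
  have h₂ : Computable fun y : List Bool × Witness => y.2.2.2 := Computable.snd.comp h₁
  have hk : Computable fun y : List Bool × Witness => y.2.2.2.1 := Computable.fst.comp h₂
  have h₃ : Computable fun y : List Bool × Witness => y.2.2.2.2 := Computable.snd.comp h₂
  have ht : Computable fun y : List Bool × Witness => y.2.2.2.2.1 := Computable.fst.comp h₃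
  have h₄ : Computable fun y : List Bool × Witness => y.2.2.2.2.2 := Computable.snd.comp h₃
  have hm : Computable fun y : List Bool × Witness => y.2.2.2.2.2.1 := Computable.fst.comp h₄
  have hv : Computable fun y : List Bool × Witness => y.2.2.2.2.2.2 := Computable.snd.comp h₄
  have hp : Computable fun y : List Bool × Witness => pieceIndex y.2.1 :=
    computable_pieceIndex.comp hi
  have hn : Computable fun y : List Bool × Witness => (pieceIndex y.2.1).2.1 :=
    Computable.fst.comp (Computable.snd.comp hp)
  have hs : Computable fun y : List Bool × Witness => (pieceIndex y.2.1).1 := Computable.fst.comp hp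
  have hq : Computable₂ fun y : List Bool × Witness => left (left (pad y.1)) :=
    computable_pad.comp (hw.comp Computable.fst) (computable_mul (Computable.const 2)
      (computable_mul (Computable.const 2) Computable.snd))
  have c₁ := computable_pad.comp hw (computable_mul (Computable.const 2)
    (computable_add (computable_mul (Computable.const 2) hi) (Computable.const 1)))
  have c₂ := computable_pad.comp hw (computable_add (computable_mul (Computable.const 2)
    (Primrec₂.natPair.to_comp.comp hl ha)) (Computable.const 1))
  have c₃ := Primrec.eq.decide.to_comp.comp
    (Primrec.list_take.to_comp.comp (Computable.list_length.comp hs) ht) hs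
  have c₄ := computable_le (computable_mul (Computable.const 4) (Computable.list_length.comp ht))
    (Computable.list_length.comp hw)
  exact computable_and (computable_and c₁ c₂) (computable_or (computable_farTest hD hp ha hl hk)
    (computable_and (computable_and c₃ c₄) (computable_and (computable_nearTest hD ht ha hl)
      (computable_rejectTest K hq hn ht hm hv))))

theorem computable_outsideBit (K : TypeTwoMachine) {D : ℕ × ℕ × ℕ → ℕ} (hD : Computable D) :
    Computable (outsideBit K D) :=
  (computable_outsideTest K hD).comp Computable.id (Computable.option_getD
    (Computable.decode.comp (Computable.fst.comp (Computable.unpair.comp Computable.list_length)))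
    (Computable.const _))

end Computability

theorem exists_machine_outsideBit (K : TypeTwoMachine) {D : ℕ × ℕ × ℕ → ℕ} (hD : Computable D) :
    ∃ M : TypeTwoMachine, ∀ p, M.Writes p fun j => outsideBit K D (initSeg p j) := by
  refine exists_machine_of_modulus (F := fun p j => outsideBit K D (initSeg p j)) (β := id)
    Computable.id ((computable_outsideBit K hD).comp (computable_initSeg ?_ Computable.snd))
    fun p q j h => by rw [(initSeg_eq_iff (n := j)).2 h]
  exact computable_pad.comp (Computable.fst.comp Computable.fst) Computable.snd

section Outside

variable {X : Type*} [MetricSpace X] {c : ComputableMetric X} {D : ℕ × ℕ × ℕ → ℕ}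

theorem not_mem_piece_of_outsideTest
    (hD : c.HasBounds D)
    {K : TypeTwoMachine} {q : Cantor} {i j : ℕ} {x : X} {s : ℕ → ℕ}
    (hs : ∀ k, dist (c.pt (s k)) x ≤ 1 / 2 ^ k) {z : Witness}
    (h : outsideTest K D (initSeg (pair (pair q (natName i)) (seqName s)) j) z = true) :
    x ∉ c.piece K q (pieceIndex i) := by
  obtain ⟨i', ⟨a, l⟩, k, t, m, v⟩ := z
  simp only [outsideTest, Bool.and_eq_true, Bool.or_eq_true, decide_eq_true_iff,
    initSeg_length] at h
  obtain ⟨⟨h₁, h₂⟩, h₃⟩ := h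
  obtain rfl : i' = i := by
    have := eq_true_of_pad_initSeg h₁
    change right (left (pair (pair q (natName i)) (seqName s))) i' = true at this
    simpa [natName] using this
  obtain rfl : a = s l := by
    have := eq_true_of_pad_initSeg h₂
    change right (pair (pair q (natName i')) (seqName s)) _ = true at this
    simpa [seqName] using this
  rintro ⟨hx₁, hx₂⟩
  rcases h₃ with h₃ | ⟨⟨h₃, h₄⟩, h₅, h₆⟩
  · simp only [farTest, Bool.and_eq_true, decide_eq_true_iff] at h₃
    have e₁ := far_iff.1 h₃.2
    have e₂ := hx₁ k h₃.1
    have e₃ := (hD (entry (pieceIndex i').1 k) (s l) l x (hs l)).1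
    linarith
  · refine hx₂ t (List.prefix_iff_eq_take.2 h₃.symm) (fun k hk => ?_) ⟨m, v, ?_⟩
    · simp only [nearTest, List.all_eq_true, List.mem_range, decide_eq_true_iff] at h₅
      exact (hD (entry t k) (s l) l x (hs l)).2.trans_lt (near_iff.1 (h₅ k hk))
    · simp only [rejectTest, Bool.and_eq_true, decide_eq_true_iff] at h₆
      rw [initSeg_pair_congr (fun _ _ => rfl) fun k hk => ?_] at h₆
      · exact h₆
      · change pad _ (2 * (2 * k)) = _
        rw [pad_initSeg (by omega)]
        change left (left (pair (pair q (natName i')) (seqName s))) k = q k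
        simp

theorem exists_outsideBit_iff
    (hD : c.HasBounds D)
    {K : TypeTwoMachine} {q : Cantor} {i : ℕ} {x : X} {s : ℕ → ℕ}
    (hs : ∀ k, dist (c.pt (s k)) x ≤ 1 / 2 ^ k) :
    x ∉ c.piece K q (pieceIndex i) ↔
      ∃ j, outsideBit K D (initSeg (pair (pair q (natName i)) (seqName s)) j) = true := by
  refine ⟨fun hx => ?_, fun ⟨j, hj⟩ => not_mem_piece_of_outsideTest hD hs hj⟩
  -- It suffices to find a witness confirmed by all sufficiently long prefixes.
  suffices h : ∃ (l : ℕ) (k : ℕ) (t : List ℕ) (m : ℕ) (v : List Bool),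
      farTest D (pieceIndex i) (s l) l k = true ∨ ((pieceIndex i).1 <+: t ∧
        nearTest D t (s l) l = true ∧ rejectTest K q (pieceIndex i).2.1 t m v = true) by
    obtain ⟨l, k, t, m, v, h⟩ := h
    let z : Witness := (i, (s l, l), k, t, m, v)
    set j := Nat.pair (Encodable.encode z)
      ((4 * i + 3) + (2 * Nat.pair l (s l) + 2) + 4 * t.length) with hj
    have hle : (4 * i + 3) + (2 * Nat.pair l (s l) + 2) + 4 * t.length ≤ j := Nat.right_le_pair _ _
    refine ⟨j, ?_⟩
    rw [outsideBit, initSeg_length, hj, Nat.unpair_pair, ← hj, Encodable.encodek, Option.getD_some]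
    have e₁ : pad (initSeg (pair (pair q (natName i)) (seqName s)) j) (2 * (2 * i + 1)) = true := by
      rw [pad_initSeg (by omega)]
      change right (left (pair (pair q (natName i)) (seqName s))) i = true
      simp [natName]
    have e₂ : pad (initSeg (pair (pair q (natName i)) (seqName s)) j)
        (2 * Nat.pair l (s l) + 1) = true := by
      rw [pad_initSeg (by omega)]
      change right (pair (pair q (natName i)) (seqName s)) _ = true
      simp [seqName]
    simp only [outsideTest, z, e₁, e₂, Bool.and_true, Bool.true_and, Bool.or_eq_true]
    refine h.imp_right fun ⟨h₁, h₂, h₃⟩ => ?_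
    rw [h₂, Bool.true_and, Bool.and_eq_true, Bool.and_eq_true, decide_eq_true_iff,
      decide_eq_true_iff, initSeg_length]
    refine ⟨⟨(List.prefix_iff_eq_take.1 h₁).symm, by omega⟩, ?_⟩
    rw [rejectTest] at h₃ ⊢
    rw [initSeg_pair_congr (fun _ _ => rfl) fun k hk => ?_]
    · exact h₃
    · change pad _ (2 * (2 * k)) = _
      rw [pad_initSeg (by omega)]
      change left (left (pair (pair q (natName i)) (seqName s))) k = q k
      simp
  by_cases hfar : ∃ k < (pieceIndex i).1.length,
      1 / 2 ^ k < dist (c.pt (entry (pieceIndex i).1 k)) x + 1 / 2 ^ (pieceIndex i).2.2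
  · obtain ⟨k, hk, hd⟩ := hfar
    obtain ⟨l, hl⟩ := (eventually_forall_lt_add_le (n := 1) (a := fun _ => 1 / 2 ^ k)
      (b := fun _ => dist (c.pt (entry (pieceIndex i).1 k)) x + 1 / 2 ^ (pieceIndex i).2.2) 4
      fun _ _ => hd).exists
    have e := (hD (entry (pieceIndex i).1 k) (s l) l x (hs l)).2
    have e' : (4 : ℝ) / 2 ^ l = 2 / 2 ^ l + 2 / 2 ^ l := by ring
    have hl0 := hl 0 one_pos
    refine ⟨l, k, [], 0, [], Or.inl ?_⟩
    rw [farTest, Bool.and_eq_true, decide_eq_true_iff, decide_eq_true_iff, far_iff]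
    exact ⟨hk, by linarith⟩
  · push Not at hfar
    have hrej : ∃ t, (pieceIndex i).1 <+: t ∧ c.Approximates t x ∧
        Rejects K q (pieceIndex i).2.1 t := by
      by_contra! h
      exact hx ⟨hfar, h⟩
    obtain ⟨t, ht, htx, m, v, hv, hmv⟩ := hrej
    obtain ⟨l, hl⟩ := (eventually_forall_lt_add_le 4 htx).exists
    have e' : (4 : ℝ) / 2 ^ l = 2 / 2 ^ l + 2 / 2 ^ l := by ring
    refine ⟨l, 0, t, m, v, Or.inr ⟨ht, ?_, ?_⟩⟩
    · simp only [nearTest, List.all_eq_true, List.mem_range, decide_eq_true_iff]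
      intro k hk
      have e := (hD (entry t k) (s l) l x (hs l)).1
      have := hl k hk
      exact near_iff.2 (by linarith)
    · rw [rejectTest, hv, hmv]
      rfl

end Outside

/-! ### Realizers on the pieces -/

/-- The operation on names of sequences that corresponds to `graft t`. -/
def graftName (t : List ℕ) (p : Cantor) : Cantor := fun k =>
  bif decide (k.unpair.1 < t.length) then decide (k.unpair.2 = entry t k.unpair.1)
  else p (Nat.pair (k.unpair.1 + 1) k.unpair.2)

theorem graftName_seqName (t : List ℕ) (s : ℕ → ℕ) :
    graftName t (seqName s) = seqName (graft t s) := by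
  funext k
  by_cases h : k.unpair.1 < t.length <;> simp [graftName, seqName, graft, h]

/-- The input for the machine `H` that is obtained from `⟨⟨q, _⟩, p⟩` on the piece with index `i`:
the name `p` is replaced by one for which the number in `i` is a correct answer. -/
def pieceInput (i : List ℕ × ℕ × ℕ) (r : Cantor) : Cantor :=
  pair (pair (graftName i.1 (right r)) (left (left r))) (natName i.2.1)

/-- A modulus of continuity of `pieceInput i`, for all `i`. -/
def pieceModulus (j : ℕ) : ℕ :=
  j + 1 + (2 * Nat.pair ((j / 2 / 2).unpair.1 + 1) (j / 2 / 2).unpair.2 + 1)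

theorem pieceInput_congr {i : List ℕ × ℕ × ℕ} {r r' : Cantor} {j : ℕ}
    (h : ∀ k < pieceModulus j, r k = r' k) : pieceInput i r j = pieceInput i r' j := by
  have h₁ : right r (Nat.pair ((j / 2 / 2).unpair.1 + 1) (j / 2 / 2).unpair.2) =
      right r' (Nat.pair ((j / 2 / 2).unpair.1 + 1) (j / 2 / 2).unpair.2) :=
    h _ (by rw [pieceModulus]; omega)
  have h₂ : left (left r) (j / 2 / 2) = left (left r') (j / 2 / 2) :=
    h _ (by rw [pieceModulus]; omega)
  simp only [pieceInput, pair, graftName, h₁, h₂]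

/-- The `j`-th symbol of `pieceInput`, on the input `⟨⟨q, natName i⟩, p⟩` of which the prefix `w` has
been read: the code `i` of the index is guessed as the first component of the length of `w`. -/
def pieceInputBit (w : List Bool) (j : ℕ) : Option Bool :=
  bif pad w (2 * (2 * w.length.unpair.1 + 1)) && decide (pieceModulus j ≤ w.length) then
    some (pieceInput (pieceIndex w.length.unpair.1) (pad w) j) else none

theorem computable_pieceModulus : Computable pieceModulus := by
  have hu : Computable fun j : ℕ => (j / 2 / 2).unpair :=
    Computable.unpair.comp (Primrec.nat_div.comp (Primrec.nat_div.comp Primrec.id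
      (Primrec.const 2)) (Primrec.const 2)).to_comp
  exact computable_add (computable_add Computable.id (Computable.const 1)) (computable_add
    (computable_mul (Computable.const 2) (Primrec₂.natPair.to_comp.comp
      (computable_add (Computable.fst.comp hu) (Computable.const 1)) (Computable.snd.comp hu)))
    (Computable.const 1))

theorem computable_graftName {α : Type*} [Primcodable α] {t : α → List ℕ} {p : α → Cantor}
    (ht : Computable t) (hp : Computable₂ p) : Computable₂ fun a => graftName (t a) (p a) := by
  have hu : Computable fun z : α × ℕ => z.2.unpair := Computable.unpair.comp Computable.snd
  have hk : Computable fun z : α × ℕ => z.2.unpair.1 := Computable.fst.comp hu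
  have hm : Computable fun z : α × ℕ => z.2.unpair.2 := Computable.snd.comp hu
  have ht' : Computable fun z : α × ℕ => t z.1 := ht.comp Computable.fst
  exact Computable.cond (computable_lt hk (Computable.list_length.comp ht'))
    (Primrec.eq.decide.to_comp.comp hm (computable_entry.comp ht' hk))
    (hp.comp Computable.fst (Primrec₂.natPair.to_comp.comp
      (computable_add hk (Computable.const 1)) hm))

theorem computable_pieceInputBit : Computable₂ pieceInputBit := by
  have hw : Computable fun z : List Bool × ℕ => z.1 := Computable.fst
  have hl : Computable fun z : List Bool × ℕ => z.1.length := Computable.list_length.comp hw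
  have hi : Computable fun z : List Bool × ℕ => z.1.length.unpair.1 :=
    Computable.fst.comp (Computable.unpair.comp hl)
  have hp : Computable fun z : List Bool × ℕ => pieceIndex z.1.length.unpair.1 :=
    computable_pieceIndex.comp hi
  have hr : Computable₂ fun z : List Bool × ℕ => right (pad z.1) :=
    computable_pad.comp (hw.comp Computable.fst) (computable_add
      (computable_mul (Computable.const 2) Computable.snd) (Computable.const 1))
  have hq : Computable₂ fun z : List Bool × ℕ => left (left (pad z.1)) :=
    computable_pad.comp (hw.comp Computable.fst) (computable_mul (Computable.const 2)
      (computable_mul (Computable.const 2) Computable.snd))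
  have hn : Computable₂ fun z : List Bool × ℕ => natName (pieceIndex z.1.length.unpair.1).2.1 :=
    computable_natName.comp ((Computable.fst.comp (Computable.snd.comp hp)).comp Computable.fst)
      Computable.snd
  have h : Computable₂ fun z : List Bool × ℕ =>
      pieceInput (pieceIndex z.1.length.unpair.1) (pad z.1) :=
    computable_pair (computable_pair (computable_graftName (Computable.fst.comp hp) hr) hq) hn
  exact Computable.cond (computable_and (computable_pad.comp hw (computable_mul
      (Computable.const 2) (computable_add (computable_mul (Computable.const 2) hi)
        (Computable.const 1))))
      (computable_le (computable_pieceModulus.comp Computable.snd) hl))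
    (Computable.option_some.comp (h.comp Computable.id Computable.snd)) (Computable.const none)

theorem exists_machine_pieceInput : ∃ M : TypeTwoMachine, ∀ q p i,
    M.Writes (pair (pair q (natName i)) p)
      (pair (pair (graftName (pieceIndex i).1 p) q) (natName (pieceIndex i).2.1)) := by
  refine ⟨TypeTwoMachine.ofBits _ computable_pieceInputBit, fun q p i => ?_⟩
  have e : pair (pair (graftName (pieceIndex i).1 p) q) (natName (pieceIndex i).2.1) =
      pieceInput (pieceIndex i) (pair (pair q (natName i)) p) := by simp [pieceInput]
  have hi : ∀ k, pair (pair q (natName i)) p (2 * (2 * k + 1)) = natName i k := fun k => by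
    change right (left (pair (pair q (natName i)) p)) k = _
    simp
  rw [e]
  refine TypeTwoMachine.ofBits_writes _ (fun m j b h => ?_) fun j => ?_
  · rw [pieceInputBit, initSeg_length] at h
    cases hc : pad (initSeg (pair (pair q (natName i)) p) m) (2 * (2 * m.unpair.1 + 1)) &&
      decide (pieceModulus j ≤ m) with
    | false => simp [hc] at h
    | true =>
      rw [hc, cond_true, Option.some_inj] at h
      rw [Bool.and_eq_true, decide_eq_true_iff] at hc
      have hm := eq_true_of_pad_initSeg hc.1
      rw [hi, natName, decide_eq_true_iff] at hm
      rw [← h, hm]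
      exact pieceInput_congr fun k hk => pad_initSeg (hk.trans_le hc.2)
  · have hle := Nat.right_le_pair i (4 * i + 3 + pieceModulus j)
    refine ⟨Nat.pair i (4 * i + 3 + pieceModulus j), ?_⟩
    rw [pieceInputBit, initSeg_length, Nat.unpair_pair, pad_initSeg (by omega), hi,
      decide_eq_true (by omega)]
    simp [natName]

end CompAnalysis

theorem theorem9 {X Y Z : Type*} [MetricSpace X] [MetricSpace Z]
    (cX : ComputableMetric X) (δY : CantorRep Y) (cZ : ComputableMetric Z)
    (f : X × Y → Z)
    (hf : WeihrauchReducible (cX.cauchyRep.prod δY) cZ.cauchyRep (closedRep natRep) natRep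
      (fun z => {f z}) (closedChoice natRep)) :
    ∃ F : Y → PiecewiseContinuousMap cX.cauchyRep cZ.cauchyRep,
      (∀ y x, (F y).1 x = f (x, y)) ∧
        IsComputableMap δY (piecewiseRep cX.cauchyRep cZ.cauchyRep) F := by
  obtain ⟨H, K, hHK⟩ := exists_isChoiceReduction hf
  obtain ⟨D, hDc, hD⟩ := exists_computable_bounds cX
  -- On inputs `⟨⟨q, natName i⟩, p⟩`, the machine `M₁` recognizes that the point with name `p` lies
  -- outside the `i`-th piece, and the machine `H.comp M₂` evaluates `f` if it lies inside.
  obtain ⟨M₁, hM₁⟩ := exists_machine_outsideBit K hDc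
  obtain ⟨M₂, hM₂⟩ := exists_machine_pieceInput
  obtain ⟨M₃, hM₃⟩ := exists_machine_pair_sectionCode M₁ (H.comp M₂)
  obtain ⟨M₄, hM₄⟩ := exists_machine_sectionCode M₃
  have hnames : ∀ {q y x} {s : ℕ → ℕ}, δY.Names q y →
      (∀ k, dist (cX.pt (s k)) x ≤ 1 / 2 ^ k) →
        (cX.cauchyRep.prod δY).Names (pair (seqName s) q) (x, y) := fun {q y x s} hq hs =>
    ⟨by rw [left_pair]; exact ComputableMetric.names_iff.2 ⟨s, rfl, hs⟩, by rwa [right_pair]⟩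
  have main : ∀ q y, δY.Names q y →
      IsPiecewiseName cX.cauchyRep cZ.cauchyRep (sectionCode M₃ q) fun x => f (x, y) := by
    intro q y hq
    refine ⟨fun i => cX.piece K q (pieceIndex i), Set.eq_univ_of_forall fun x => ?_, ?_⟩
    · obtain ⟨i, hi⟩ := exists_mem_piece (c := cX) (K := K) (q := q) (x := x) fun s hs => by
        obtain ⟨u, B, hu, hB, hne, -⟩ := hHK _ _ (hnames hq hs)
        exact ⟨u, B, hu, hB, hne⟩
      exact Set.mem_iUnion.2 ⟨Encodable.encode i, by rwa [pieceIndex_encode]⟩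
    · rintro n i hn
      obtain rfl := names_natRep_iff.1 hn
      refine ⟨_, univWrites_sectionCode (hM₃ _), ?_, ?_⟩
      · rw [left_pair]
        intro p x hp
        obtain ⟨s, rfl, hs⟩ := ComputableMetric.names_iff.1 hp
        exact ⟨_, univWrites_sectionCode (hM₁ _), exists_outsideBit_iff hD hs⟩
      · rw [right_pair]
        rintro p ⟨x, hx⟩ hp
        obtain ⟨s, rfl, hs⟩ := ComputableMetric.names_iff.1 hp
        obtain ⟨u, B, hu, hB, -, hH⟩ := hHK _ _ (hnames hq fun k => (dist_graft_lt hx hs k).le)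
        obtain ⟨r, hr, hrf⟩ := hH _ (mem_of_mem_piece hx hs hu hB)
        rw [← graftName_seqName] at hr
        exact ⟨r, univWrites_sectionCode (TypeTwoMachine.comp_writes (hM₂ _ _ _) hr), hrf⟩
  refine ⟨fun y => ⟨fun x => f (x, y), ?_⟩, fun _ _ => rfl, M₄.toPFun, M₄.isComputable_toPFun, ?_⟩
  · obtain ⟨q, hq⟩ := δY.surj y
    exact ⟨_, main q y hq⟩
  · intro q y hq _
    exact ⟨_, TypeTwoMachine.mem_toPFun.2 (hM₄ q), _, rfl, main q y hq⟩
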